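/- Let $n\ge 2$, let $\Omega\subseteq\mathbb{R}^n$ be a domain (a nonempty open connected set), and let $\mathcal{M}^+(\Omega)$ denote the class of nonnegative locally finite Borel (Radon) measures on $\Omega$. Let $G:\Omega\times\Omega\to(0,\infty]$ be a positive lower semicontinuous kernel, and for $\omega\in\mathcal{M}^+(\Omega)$ put $\mathbf{G}\omega(x)=\int_\Omega G(x,y)\,d\omega(y)$, $x\in\Omega$. Assume that $G$ satisfies the weak maximum principle: there is a constant $h\ge 1$ such that for every $\omega\in\mathcal{M}^+(\Omega)$, if $\mathbf{G}\omega\le 1$ on $\operatorname{supp}\omega$, then $\mathbf{G}\omega\le h$ on $\Omega$. The kernel $G$ is called quasi-symmetric if there is a constant $a\ge 1$ with $a^{-1}G(y,x)\le G(x,y)\le a\,G(y,x)$ for all $x,y\in\Omega$. Let $0<q<1$, $\gamma>0$, and let $\sigma,\mu\in\mathcal{M}^+(\Omega)$ with $\sigma\not\equiv 0$. For $0<p<\infty$, $L^p(\Omega,d\sigma)$ is the space of measurable functions $f$ with $\int_\Omega|f|^p\,d\sigma<\infty$. Consider the conditions $$\mathbf{G}\sigma\in L^{\frac{\gamma+q}{1-q}}(\Omega,d\sigma)\tag{1}$$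 $$\mathbf{G}\mu\in L^{\gamma+q}(\Omega,d\sigma)\tag{2}$$ and the integral equation $$u=\mathbf{G}(u^q\,d\sigma)+\mathbf{G}\mu\quad\text{in }\Omega.\tag{3}$$ A positive solution of (3) is a measurable function $u:\Omega\to(0,\infty]$ with $u\in L^q_{loc}(\Omega,d\sigma)$ for which (3) holds at every point of $\Omega$. (a) If $G$ is quasi-symmetric and (1) and (2) hold, then there exists a positive solution $u\in L^{\gamma+q}(\Omega,d\sigma)$ of (3). Moreover, $u$ can be obtained by monotone iteration: $u=\lim_{j\to\infty}u_j$ pointwise for a pointwise nondecreasing sequence with $u_{j+1}=\mathbf{G}(u_j^q\,d\sigma)+\mathbf{G}\mu$ for $j\ge 0$, where $u_0=\mathbf{G}\mu$ if $\mu\not\equiv 0$, and $u_0=\kappa\,(\mathbf{G}\sigma)^{\frac{1}{1-q}}$ for some constant $\kappa>0$ if $\mu\equiv 0$. (b) Conversely, without assuming that $G$ is quasi-symmetric, if there exists a positive solution $u\in L^{\gamma+q}(\Omega,d\sigma)$ of (3), then (1) and (2) hold. -/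

import Mathlib

open MeasureTheory Set
open scoped ENNReal NNReal

noncomputable section

namespace SublinearPotential

/-- The potential `Gω(x) = ∫ G(x, y) dω(y)` of a measure `ω` with respect to the kernel `G`. -/
def potential {X : Type*} [MeasurableSpace X] (G : X → X → ℝ≥0∞) (ω : Measure X) (x : X) : ℝ≥0∞ :=
  ∫⁻ y, G x y ∂ω

/-- The weak maximum principle with constant `h`: for every locally finite Borel measure `ω`,
if `Gω ≤ 1` on the support of `ω`, then `Gω ≤ h` everywhere. -/
def WeakMaximumPrinciple {X : Type*} [TopologicalSpace X] [MeasurableSpace X]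
    (G : X → X → ℝ≥0∞) (h : ℝ≥0) : Prop :=
  ∀ ω : Measure X, IsLocallyFiniteMeasure ω →
    (∀ x ∈ ω.support, potential G ω x ≤ 1) → ∀ x, potential G ω x ≤ h

/-- Quasi-symmetry: `a⁻¹ G(y, x) ≤ G(x, y) ≤ a G(y, x)` for some constant `a ≥ 1`. -/
def QuasiSymmetric {X : Type*} (G : X → X → ℝ≥0∞) : Prop :=
  ∃ a : ℝ≥0, 1 ≤ a ∧ ∀ x y, (a : ℝ≥0∞)⁻¹ * G y x ≤ G x y ∧ G x y ≤ a * G y x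

/-- The right-hand side `G(u^q dσ) + Gμ` of the integral equation, as a function on `X`. -/
def solutionOperator {X : Type*} [MeasurableSpace X] (G : X → X → ℝ≥0∞) (q : ℝ)
    (σ μ : Measure X) (u : X → ℝ≥0∞) (x : X) : ℝ≥0∞ :=
  potential G (σ.withDensity fun y => u y ^ q) x + potential G μ x

/-- `u` is a positive solution of `u = G(u^q dσ) + Gμ`: a measurable function with values in
`(0, ∞]`, in `L^q_loc(dσ)`, for which the equation holds at every point. -/
structure IsPositiveSolution {X : Type*} [TopologicalSpace X] [MeasurableSpace X]
    (G : X → X → ℝ≥0∞) (q : ℝ) (σ μ : Measure X) (u : X → ℝ≥0∞) : Prop where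
  measurable : Measurable u
  pos : ∀ x, 0 < u x
  locallyIntegrable : ∀ K : Set X, IsCompact K → ∫⁻ x in K, u x ^ q ∂σ < ∞
  eq : ∀ x, u x = solutionOperator G q σ μ u x

/-- `u` is obtained by monotone iteration: it is the pointwise limit of an increasing sequence
`v (j + 1) = G((v j)^q dσ) + Gμ`, started at `v 0 = Gμ` if `μ ≠ 0`, and at
`v 0 = κ (Gσ)^(1/(1-q))` with some constant `κ > 0` if `μ = 0`. -/
def IsMonotoneIterationLimit {X : Type*} [MeasurableSpace X]
    (G : X → X → ℝ≥0∞) (q : ℝ) (σ μ : Measure X) (u : X → ℝ≥0∞) : Prop :=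
  ∃ v : ℕ → X → ℝ≥0∞,
    (μ ≠ 0 → ∀ x, v 0 x = potential G μ x) ∧
    (μ = 0 → ∃ κ : ℝ≥0, 0 < κ ∧ ∀ x, v 0 x = κ * potential G σ x ^ (1 / (1 - q))) ∧
    (∀ j x, v (j + 1) x = solutionOperator G q σ μ (v j) x) ∧
    Monotone v ∧
    ∀ x, u x = ⨆ j, v j x

end SublinearPotential

end

/-!
Write `w = Gσ` and `r = γ + q`, so that `r > q`. Everything rests on one consequence of the weak
maximum principle and lower semicontinuity: the level set `E = {Gω ≤ t}` is closed and carries the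
restriction `ω|E`, hence `G(ω|E) ≤ h t` everywhere (`potential_restrict_le`). So at a point `x` with
`Gω(x) = M`, at least half of the mass of `G(x, ·) dω` sits where `Gω > M / (2h)`. This gives the
iterated inequality `(Gω)^s ≤ C G((Gω)^(s-1) dω)` for `s ≥ 1` (`potential_rpow_le`); summing over
dyadic level sets gives a reverse inequality `G(w^(-β) dσ) ≤ C w^(1-β)` for `0 ≤ β < 1`
(`exists_lintegral_kernel_mul_rpow_neg_le`).

Necessity. If `u ≥ G(u^q dσ)` is positive, restrict `σ` to the set `B` where `u` lies between `1/k`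
and `k`. With `s = 1/(1-q)` one has `(Gσ_B)^s ≤ E u` on `B` for some finite `E`, and the iterated
inequality improves `E` to `c E^q`. Repeating this, the constant tends to the fixed point `c^s`,
which does not depend on `k`, and letting `k → ∞` gives `w^(1/(1-q)) ≤ c^s u`
(`potential_rpow_le_of_supersolution`). Since also `Gμ ≤ u`, both integrability conditions follow.

Sufficiency. Under quasi-symmetry and `w ∈ L^(r/(1-q))(σ)`, the operator `f ↦ G(f dσ)` maps
`L^(r/q)(σ)` to `L^r(σ)` (`strong_type`). For `r < 1` this is Hölder's inequality with the weight
`w^(-β)`, `β = (1-r)/(1-q)`: quasi-symmetry moves the potential onto the weight, where the reverse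
inequality applies. For `r ≥ 1` the iterated inequality with `s = r` and quasi-symmetry bound
`∫ (G(f dσ))^r dσ` by a multiple of `∫ w f (G(f dσ))^(r-1) dσ`, and Hölder's inequality allows the
last factor to be absorbed, after a truncation that makes it finite. Consequently the `L^r` norms of
the monotone iterates satisfy a sublinear recursion and stay bounded
(`exists_bound_of_sublinear_recursion`), and their limit is the solution. When `μ = 0` the iteration
starts from the subsolution `κ w^(1/(1-q))` provided by the iterated inequality.
-/

namespace SublinearPotential
open Filter Topology

/-! ### Inequalities for extended nonnegative numbers and integrals -/

/-- Hölder's inequality for three functions, with exponents summing to `1`. -/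
lemma lintegral_mul_rpow_mul_rpow_mul_rpow_le {α : Type*} [MeasurableSpace α] {ν : Measure α}
    {f g k : α → ℝ≥0∞} (hf : AEMeasurable f ν) (hg : AEMeasurable g ν) (hk : AEMeasurable k ν)
    {a b c : ℝ} (ha : 0 ≤ a) (hb : 0 ≤ b) (hc : 0 ≤ c) (habc : a + b + c = 1) :
    ∫⁻ x, f x ^ a * g x ^ b * k x ^ c ∂ν ≤
      (∫⁻ x, f x ∂ν) ^ a * (∫⁻ x, g x ∂ν) ^ b * (∫⁻ x, k x ∂ν) ^ c := by
  have := ENNReal.lintegral_prod_norm_pow_le (μ := ν) Finset.univ (f := ![f, g, k])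
    (p := ![a, b, c]) (by intro i _; fin_cases i <;> simpa) (by simpa [Fin.sum_univ_three])
    (by intro i _; fin_cases i <;> simpa)
  simpa [Fin.prod_univ_three] using this

lemma memLp_ofReal_iff {α : Type*} [MeasurableSpace α] {ν : Measure α} {f : α → ℝ≥0∞}
    (hf : Measurable f) {p : ℝ} (hp : 0 < p) :
    MemLp f (ENNReal.ofReal p) ν ↔ ∫⁻ x, f x ^ p ∂ν < ∞ := by
  rw [MemLp, and_iff_right hf.aestronglyMeasurable,
    eLpNorm_lt_top_iff_lintegral_rpow_enorm_lt_top (by simpa using hp) (by simp),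
    ENNReal.toReal_ofReal hp.le]
  simp

/-- Dyadic bound for a negative power: values `z ≥ M` are covered by the first term, and a value
`z < M` by the term of the series with `M 2^(-k-1) < z ≤ M 2^(-k)`. -/
lemma rpow_neg_le_add_tsum {β : ℝ} (hβ : 0 ≤ β) {M z : ℝ≥0∞} (hM : M ≠ ∞) (hz : z ≠ 0) :
    z ^ (-β) ≤ M ^ (-β) +
      ∑' k : ℕ, (if z ≤ M * 2⁻¹ ^ k then (M * 2⁻¹ ^ (k + 1)) ^ (-β) else 0) := by
  have anti : ∀ {a b : ℝ≥0∞}, a ≤ b → b ^ (-β) ≤ a ^ (-β) := fun {a b} hab => by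
    rw [ENNReal.rpow_neg, ENNReal.rpow_neg, ENNReal.inv_le_inv]
    gcongr
  rcases le_or_gt M z with hMz | hMz
  · exact (anti hMz).trans le_self_add
  have hex : ∃ k : ℕ, M * 2⁻¹ ^ k < z := by
    have : Tendsto (fun k : ℕ => M * (2⁻¹ : ℝ≥0∞) ^ k) atTop (𝓝 (M * 0)) :=
      ENNReal.Tendsto.const_mul (ENNReal.tendsto_pow_atTop_nhds_zero_of_lt_one (by simp))
        (Or.inr hM)
    rw [mul_zero] at this
    exact (this.eventually_lt_const (pos_iff_ne_zero.2 hz)).exists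
  classical
  obtain ⟨k, hk⟩ : ∃ k, Nat.find hex = k + 1 := by
    refine Nat.exists_eq_succ_of_ne_zero fun h0 => ?_
    have := Nat.find_spec hex
    rw [h0, pow_zero, mul_one] at this
    exact lt_asymm this hMz
  have h1 : M * 2⁻¹ ^ (k + 1) < z := hk ▸ Nat.find_spec hex
  have h2 : z ≤ M * 2⁻¹ ^ k := not_lt.1 (Nat.find_min hex (by omega))
  refine le_trans ?_ (le_trans (ENNReal.le_tsum k) le_add_self)
  rw [if_pos h2]
  exact anti h1.le

/-- A sequence with `I (j + 1) ≤ A (I j ^ q + 1)`, `0 < q < 1`, is bounded: the bound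
`L = c^(1/(1-q))` solves `L = c L^q`, and `c` is chosen large enough to preserve `I j ≤ L`. -/
lemma exists_bound_of_sublinear_recursion {q : ℝ} (hq : 0 < q) (hq1 : q < 1) {I : ℕ → ℝ≥0∞}
    {A : ℝ≥0∞} (hA : A ≠ ∞) (h0 : I 0 ≠ ∞) (hI : ∀ j, I (j + 1) ≤ A * (I j ^ q + 1)) :
    ∃ L : ℝ≥0∞, L ≠ ∞ ∧ ∀ j, I j ≤ L := by
  have h1q : 0 < 1 - q := by linarith
  set c : ℝ≥0∞ := 2 * A + 1 + I 0 with hc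
  have hct : c ≠ ∞ := by simp [hc, hA, h0, ENNReal.mul_eq_top]
  have hc1 : 1 ≤ c := le_trans le_add_self le_self_add
  have hc0 : c ≠ 0 := (zero_lt_one.trans_le hc1).ne'
  have hs1 : 1 ≤ 1 / (1 - q) := by rw [le_div_iff₀ h1q]; linarith
  set L := c ^ (1 / (1 - q)) with hL
  have hcL : c ≤ L := by
    calc c = c ^ (1 : ℝ) := (ENNReal.rpow_one c).symm
      _ ≤ _ := ENNReal.rpow_le_rpow_of_exponent_le hc1 hs1
  have hLq1 : 1 ≤ L ^ q := ENNReal.one_le_rpow (hc1.trans hcL) hq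
  have hcLq : c * L ^ q = L := by
    nth_rewrite 1 [← ENNReal.rpow_one c]
    rw [hL, ← ENNReal.rpow_mul, ← ENNReal.rpow_add _ _ hc0 hct]
    congr 1; field_simp; ring
  refine ⟨L, ENNReal.rpow_ne_top_of_nonneg (by positivity) hct, fun j => ?_⟩
  induction j with
  | zero => exact le_add_self.trans hcL
  | succ j ih =>
    calc I (j + 1) ≤ A * (I j ^ q + 1) := hI j
      _ ≤ A * (L ^ q + L ^ q) := by gcongr
      _ = 2 * A * L ^ q := by ring
      _ ≤ c * L ^ q := by gcongr; exact le_self_add.trans le_self_add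
      _ = L := hcLq

lemma monotone_solutionOperator {X : Type*} [MeasurableSpace X] (G : X → X → ℝ≥0∞) {q : ℝ}
    (hq : 0 ≤ q) (σ μ : Measure X) :
    Monotone (solutionOperator G q σ μ) := by
  intro u v huv x
  refine add_le_add_left ?_ _
  exact lintegral_mono' (withDensity_mono (Eventually.of_forall fun y =>
    ENNReal.rpow_le_rpow (huv y) hq)) le_rfl

/-! ### Potentials and the solution operator -/

variable {X : Type*} [TopologicalSpace X] [MeasurableSpace X] [BorelSpace X] {G : X → X → ℝ≥0∞}

lemma measurable_kernel_left (hG : LowerSemicontinuous fun p : X × X => G p.1 p.2) (x : X) :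
    Measurable (G x) :=
  (hG.comp (Continuous.prodMk_right x)).measurable

lemma potential_withDensity (hG : LowerSemicontinuous fun p : X × X => G p.1 p.2)
    (ω : Measure X) {f : X → ℝ≥0∞} (hf : Measurable f) (x : X) :
    potential G (ω.withDensity f) x = ∫⁻ y, G x y * f y ∂ω := by
  rw [potential, lintegral_withDensity_eq_lintegral_mul _ hf (measurable_kernel_left hG x)]
  simp only [Pi.mul_apply, mul_comm]

lemma potential_pos (hG : LowerSemicontinuous fun p : X × X => G p.1 p.2)
    (hpos : ∀ x y, 0 < G x y) {ω : Measure X} (hω : ω ≠ 0) (x : X) : 0 < potential G ω x := by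
  rw [potential, lintegral_pos_iff_support (measurable_kernel_left hG x)]
  have : Function.support (G x) = univ := by
    ext y; simp [(hpos x y).ne']
  rw [this]
  exact (Measure.measure_univ_pos).2 hω

/-- A positive lower semicontinuous kernel is locally bounded below, so a potential that is finite
at a single point forces the measure to be locally finite. This lets the weak maximum principle be
applied to measures that are not known to be locally finite. -/
lemma isLocallyFiniteMeasure_of_potential_lt_top
    (hG : LowerSemicontinuous fun p : X × X => G p.1 p.2) (hpos : ∀ x y, 0 < G x y)
    {ω : Measure X} {x : X} (hx : potential G ω x < ∞) : IsLocallyFiniteMeasure ω := by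
  refine ⟨fun y => ?_⟩
  obtain ⟨c, hc0, hc⟩ := exists_between (hpos x y)
  have hU : {z | c < G x z} ∈ 𝓝 y := (hG.comp (Continuous.prodMk_right x)) y c hc
  refine ⟨_, hU, ?_⟩
  have h1 : c * ω {z | c ≤ G x z} ≤ potential G ω x :=
    mul_meas_ge_le_lintegral (measurable_kernel_left hG x) c
  have h2 : c * ω {z | c < G x z} ≤ potential G ω x :=
    le_trans (by gcongr; exact fun h => h.le) h1
  by_contra hcon
  rw [not_lt, top_le_iff] at hcon
  rw [hcon, ENNReal.mul_top hc0.ne'] at h2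
  exact absurd hx (not_lt.2 h2)

lemma solutionOperator_apply (hG : LowerSemicontinuous fun p : X × X => G p.1 p.2) (q : ℝ)
    (σ μ : Measure X) {u : X → ℝ≥0∞} (hu : Measurable u) (x : X) :
    solutionOperator G q σ μ u x = ∫⁻ y, G x y * u y ^ q ∂σ + potential G μ x := by
  rw [solutionOperator, potential_withDensity hG σ (hu.pow_const q)]

lemma solutionOperator_iSup (hG : LowerSemicontinuous fun p : X × X => G p.1 p.2) {q : ℝ}
    (hq : 0 < q) (σ μ : Measure X) {v : ℕ → X → ℝ≥0∞} (hv : ∀ j, Measurable (v j))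
    (hmono : Monotone v) (x : X) :
    solutionOperator G q σ μ (fun y => ⨆ j, v j y) x =
      ⨆ j, solutionOperator G q σ μ (v j) x := by
  rw [solutionOperator_apply hG q σ μ (Measurable.iSup hv)]
  simp only [solutionOperator_apply hG q σ μ (hv _)]
  rw [← ENNReal.iSup_add]
  congr 1
  have hm : ∀ j, Measurable fun y => G x y * v j y ^ q := fun j =>
    (measurable_kernel_left hG x).mul ((hv j).pow_const q)
  rw [← lintegral_iSup hm]
  · refine lintegral_congr fun y => ?_
    rw [← ENNReal.mul_iSup]
    congr 1
    exact (ENNReal.orderIsoRpow q hq).map_iSup _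
  · intro i j hij y
    exact mul_le_mul_right (ENNReal.rpow_le_rpow (hmono hij y) hq.le) _

variable [SecondCountableTopology X]

lemma lowerSemicontinuous_potential (hG : LowerSemicontinuous fun p : X × X => G p.1 p.2)
    (ω : Measure X) : LowerSemicontinuous (potential G ω) := by
  rw [lowerSemicontinuous_iff_le_liminf]
  intro x
  calc potential G ω x ≤ ∫⁻ y, liminf (fun z => G z y) (𝓝 x) ∂ω :=
        lintegral_mono fun y =>
          (hG.comp (Continuous.prodMk_left y)).le_liminf x
    _ ≤ _ := lintegral_liminf_le fun z => measurable_kernel_left hG z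

lemma measurable_potential (hG : LowerSemicontinuous fun p : X × X => G p.1 p.2)
    (ω : Measure X) : Measurable (potential G ω) :=
  (lowerSemicontinuous_potential hG ω).measurable

/-! ### Consequences of the weak maximum principle -/

/-- The weak maximum principle on level sets: the set `{Gω ≤ t}` is closed by lower semicontinuity,
so it contains the support of the restricted measure. -/
lemma potential_restrict_le (hG : LowerSemicontinuous fun p : X × X => G p.1 p.2)
    (hpos : ∀ x y, 0 < G x y) {h : ℝ≥0} (hW : WeakMaximumPrinciple G h) (ω : Measure X)
    {t : ℝ≥0∞} (ht0 : t ≠ 0) (ht : t ≠ ∞) (x : X) :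
    potential G (ω.restrict {y | potential G ω y ≤ t}) x ≤ h * t := by
  set E := {y | potential G ω y ≤ t} with hE
  have hEc : IsClosed E := (lowerSemicontinuous_potential hG ω).isClosed_preimage t
  -- If `E` is empty the restricted measure vanishes; otherwise its potential is finite somewhere.
  rcases E.eq_empty_or_nonempty with h0 | ⟨x₀, hx₀⟩
  · simp [h0, potential]
  have hle : ∀ z, potential G (ω.restrict E) z ≤ potential G ω z := fun z =>
    lintegral_mono' Measure.restrict_le_self le_rfl
  have hsm : ∀ z, potential G (t⁻¹ • ω.restrict E) z = t⁻¹ * potential G (ω.restrict E) z :=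
    fun z => by simp [potential, lintegral_smul_measure]
  have hlf : IsLocallyFiniteMeasure (t⁻¹ • ω.restrict E) := by
    refine isLocallyFiniteMeasure_of_potential_lt_top hG hpos (x := x₀) ?_
    rw [hsm]
    exact ENNReal.mul_lt_top (by simpa [pos_iff_ne_zero] using ht0)
      (((hle x₀).trans hx₀).trans_lt ht.lt_top)
  have key := hW (t⁻¹ • ω.restrict E) hlf (fun z hz => ?_) x
  · rw [hsm, mul_comm, ← div_eq_mul_inv, ENNReal.div_le_iff ht0 ht] at key
    exact key
  · have hzE : z ∈ E := by
      refine Measure.support_subset_of_isClosed hEc ?_ hz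
      refine Measure.ae_smul_measure ?_ _
      exact ae_restrict_mem hEc.measurableSet
    rw [hsm, mul_comm, ← div_eq_mul_inv]
    exact (ENNReal.div_le_iff ht0 ht).2 (by simpa using (hle z).trans hzE)

/-- The iterated inequality for potentials truncated at height `N`. With `m = min (Gω(x)) N` and
`t = m / (2h)`, the set `{Gω ≤ t}` contributes at most `h t = m / 2` to `Gω(x)`, so at least `m / 2`
comes from points where the truncated potential exceeds `t`. -/
lemma min_potential_rpow_le (hG : LowerSemicontinuous fun p : X × X => G p.1 p.2)
    (hpos : ∀ x y, 0 < G x y) {h : ℝ≥0} (h1 : 1 ≤ h) (hW : WeakMaximumPrinciple G h)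
    (ω : Measure X) {s : ℝ} (hs : 1 ≤ s) (N : ℝ≥0) (x : X) :
    min (potential G ω x) N ^ s ≤ 2 * (2 * (h : ℝ≥0∞)) ^ (s - 1) *
      ∫⁻ y, G x y * min (potential G ω y) N ^ (s - 1) ∂ω := by
  set g := potential G ω with hg
  set m := min (g x) N with hm
  have hmN : m ≤ N := min_le_right _ _
  have hmtop : m ≠ ∞ := (hmN.trans_lt ENNReal.coe_lt_top).ne
  rcases eq_or_ne m 0 with h0 | h0
  · rw [h0, ENNReal.zero_rpow_of_pos (by linarith)]; exact zero_le
  have hh0 : (2 * (h : ℝ≥0∞)) ≠ 0 := by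
    have : h ≠ 0 := (zero_lt_one.trans_le h1).ne'
    simp [this]
  have hht : (2 * (h : ℝ≥0∞)) ≠ ∞ := ENNReal.mul_ne_top (by simp) (by simp)
  set t := m / (2 * h) with ht
  have ht0 : t ≠ 0 := (ENNReal.div_pos h0 hht).ne'
  have httop : t ≠ ∞ := ENNReal.div_ne_top hmtop hh0
  have htm : 2 * h * t = m := ENNReal.mul_div_cancel hh0 hht
  have hth : (h : ℝ≥0∞) * t = m / 2 := by
    rw [ENNReal.eq_div_iff (by simp) (by simp), ← mul_assoc, htm]
  have htle : t ≤ m := by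
    rw [← htm]
    refine le_mul_of_one_le_left' ?_
    exact one_le_mul_of_one_le_of_one_le (by norm_num) (by exact_mod_cast h1)
  set E := {y | g y ≤ t} with hE
  have hEm : MeasurableSet E := measurable_potential hG ω measurableSet_Iic
  have hsplit : (∫⁻ y in E, G x y ∂ω) + ∫⁻ y in Eᶜ, G x y ∂ω = g x :=
    lintegral_add_compl _ hEm
  have hE1 : (∫⁻ y in E, G x y ∂ω) ≤ m / 2 := by
    rw [← hth]; exact potential_restrict_le hG hpos hW ω ht0 httop x
  have hE2 : m / 2 ≤ ∫⁻ y in Eᶜ, G x y ∂ω := by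
    have : m / 2 + m / 2 ≤ m / 2 + ∫⁻ y in Eᶜ, G x y ∂ω := by
      rw [ENNReal.add_halves]
      calc m ≤ g x := min_le_left _ _
        _ ≤ _ := by rw [← hsplit]; gcongr
    exact (ENNReal.add_le_add_iff_left (ENNReal.div_ne_top hmtop (by simp))).1 this
  have hint : m / 2 * t ^ (s - 1) ≤ ∫⁻ y, G x y * min (g y) N ^ (s - 1) ∂ω := by
    calc m / 2 * t ^ (s - 1) ≤ (∫⁻ y in Eᶜ, G x y ∂ω) * t ^ (s - 1) := by gcongr
      _ = ∫⁻ y in Eᶜ, G x y * t ^ (s - 1) ∂ω :=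
          (lintegral_mul_const _ (measurable_kernel_left hG x)).symm
      _ ≤ ∫⁻ y in Eᶜ, G x y * min (g y) N ^ (s - 1) ∂ω := by
          refine setLIntegral_mono' hEm.compl fun y hy => ?_
          have hy' : t < g y := not_le.1 hy
          gcongr
          exact le_min hy'.le (htle.trans hmN)
      _ ≤ _ := setLIntegral_le_lintegral _ _
  calc m ^ s = m * m ^ (s - 1) := by
        nth_rewrite 2 [← ENNReal.rpow_one m]
        rw [← ENNReal.rpow_add _ _ h0 hmtop]; congr 1; ring
    _ = 2 * (2 * (h : ℝ≥0∞)) ^ (s - 1) * (m / 2 * t ^ (s - 1)) := by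
        rw [← htm, ENNReal.mul_rpow_of_nonneg _ _ (by linarith), htm]
        have : 2 * (m / 2) = m := ENNReal.mul_div_cancel (by simp) (by simp)
        nth_rewrite 1 [← this]
        ring
    _ ≤ _ := by gcongr

/-- The iterated inequality `(Gω)^s ≤ C G((Gω)^(s-1) dω)`, valid also where `Gω = ∞`. -/
lemma potential_rpow_le (hG : LowerSemicontinuous fun p : X × X => G p.1 p.2)
    (hpos : ∀ x y, 0 < G x y) {h : ℝ≥0} (h1 : 1 ≤ h) (hW : WeakMaximumPrinciple G h)
    (ω : Measure X) {s : ℝ} (hs : 1 ≤ s) (x : X) :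
    potential G ω x ^ s ≤ 2 * (2 * (h : ℝ≥0∞)) ^ (s - 1) *
      ∫⁻ y, G x y * potential G ω y ^ (s - 1) ∂ω := by
  have hsup : potential G ω x ^ s = ⨆ N : ℕ, min (potential G ω x) ((N : ℝ≥0) : ℝ≥0∞) ^ s := by
    have : potential G ω x = ⨆ N : ℕ, min (potential G ω x) ((N : ℝ≥0) : ℝ≥0∞) := by
      rw [← inf_iSup_eq]
      simp [ENNReal.iSup_natCast]
    conv_lhs => rw [this]
    exact (ENNReal.orderIsoRpow s (by linarith)).map_iSup _
  rw [hsup]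
  refine iSup_le fun N => (min_potential_rpow_le hG hpos h1 hW ω hs N x).trans ?_
  gcongr with y
  exact min_le_left _ _

/-- The counterpart of `potential_rpow_le` for negative powers: on the dyadic level sets
`{Gω ≤ M 2^(-k)}`, `M = Gω(x)`, the potential at `x` is at most `h M 2^(-k)`, and the resulting
geometric series has ratio `2^(β-1) < 1`. -/
lemma exists_lintegral_kernel_mul_rpow_neg_le
    (hG : LowerSemicontinuous fun p : X × X => G p.1 p.2) (hpos : ∀ x y, 0 < G x y) {h : ℝ≥0}
    (hW : WeakMaximumPrinciple G h) {ω : Measure X} (hω : ω ≠ 0) {β : ℝ} (hβ : 0 ≤ β)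
    (hβ1 : β < 1) :
    ∃ C : ℝ≥0∞, C ≠ ∞ ∧ ∀ x, ∫⁻ y, G x y * potential G ω y ^ (-β) ∂ω ≤
      C * potential G ω x ^ (1 - β) := by
  set g := potential G ω with hg
  have hgm : Measurable g := measurable_potential hG ω
  have hg0 : ∀ y, g y ≠ 0 := fun y => (potential_pos hG hpos hω y).ne'
  set b : ℝ≥0∞ := (2⁻¹ : ℝ≥0∞) ^ (-β) with hb
  have hbt : b ≠ ∞ := by simp [hb, ENNReal.rpow_eq_top_iff]
  have hbe : b * 2⁻¹ < 1 := by
    have : b * 2⁻¹ = (2⁻¹ : ℝ≥0∞) ^ (1 - β) := by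
      rw [sub_eq_add_neg, ENNReal.rpow_add _ _ (by simp) (by simp), ENNReal.rpow_one, mul_comm]
    rw [this]
    exact ENNReal.rpow_lt_one (by simp) (by linarith)
  refine ⟨1 + h * b * (1 - b * 2⁻¹)⁻¹, ?_, fun x => ?_⟩
  · refine ENNReal.add_ne_top.2 ⟨by simp, ENNReal.mul_ne_top (ENNReal.mul_ne_top (by simp) hbt) ?_⟩
    exact ENNReal.inv_ne_top.2 (tsub_pos_of_lt hbe).ne'
  set M := g x with hM
  -- The summand `1` in the constant keeps the right-hand side infinite where `M = ∞`.
  rcases eq_or_ne M ∞ with hMt | hMt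
  · rw [hMt, ENNReal.top_rpow_of_pos (by linarith), ENNReal.mul_top (by simp)]; exact le_top
  have hM0 : M ≠ 0 := hg0 x
  have hGm := measurable_kernel_left hG x
  have hMM : M ^ (-β) * M = M ^ (1 - β) := by
    nth_rewrite 2 [← ENNReal.rpow_one M]
    rw [← ENNReal.rpow_add _ _ hM0 hMt]; congr 1; ring
  have hterm : ∀ k : ℕ, ∫⁻ y, G x y *
      (if g y ≤ M * 2⁻¹ ^ k then (M * 2⁻¹ ^ (k + 1)) ^ (-β) else 0) ∂ω ≤
      h * b * M ^ (1 - β) * (b * 2⁻¹) ^ k := by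
    intro k
    set t := M * (2⁻¹ : ℝ≥0∞) ^ k with ht
    have htt : t ≠ ∞ := ENNReal.mul_ne_top hMt (ENNReal.pow_ne_top (by simp))
    have ht0 : t ≠ 0 := mul_ne_zero hM0 (pow_ne_zero _ (by simp))
    set c := (M * (2⁻¹ : ℝ≥0∞) ^ (k + 1)) ^ (-β) with hc
    have hcv : c = M ^ (-β) * b ^ (k + 1) := by
      rw [hc, ENNReal.mul_rpow_of_ne_top hMt (ENNReal.pow_ne_top (by simp)), hb,
        ← ENNReal.rpow_natCast, ← ENNReal.rpow_natCast, ← ENNReal.rpow_mul, ← ENNReal.rpow_mul,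
        mul_comm (-β)]
    have hE : MeasurableSet {y | g y ≤ t} := hgm measurableSet_Iic
    calc _ = ∫⁻ y in {y | g y ≤ t}, G x y * c ∂ω := by
          rw [← lintegral_indicator hE]
          congr with y
          by_cases hy : g y ≤ t <;> simp [indicator, hy]
      _ = potential G (ω.restrict {y | g y ≤ t}) x * c := lintegral_mul_const _ hGm
      _ ≤ h * t * c := by
          gcongr; exact potential_restrict_le hG hpos hW ω ht0 htt x
      _ = _ := by
          rw [hcv, ht, ← hMM, mul_pow, pow_succ]; ring
  calc ∫⁻ y, G x y * g y ^ (-β) ∂ω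
      ≤ ∫⁻ y, (G x y * M ^ (-β) + ∑' k : ℕ, G x y *
        (if g y ≤ M * 2⁻¹ ^ k then (M * 2⁻¹ ^ (k + 1)) ^ (-β) else 0)) ∂ω := by
        refine lintegral_mono fun y => ?_
        dsimp only
        rw [ENNReal.tsum_mul_left, ← mul_add]
        gcongr
        exact rpow_neg_le_add_tsum hβ hMt (hg0 y)
    _ = M * M ^ (-β) + ∑' k : ℕ, ∫⁻ y, G x y *
        (if g y ≤ M * 2⁻¹ ^ k then (M * 2⁻¹ ^ (k + 1)) ^ (-β) else 0) ∂ω := by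
        rw [lintegral_add_left (hGm.mul_const _), lintegral_mul_const _ hGm, lintegral_tsum]
        · rfl
        · intro k
          exact (hGm.mul (Measurable.ite (hgm measurableSet_Iic) measurable_const
            measurable_const)).aemeasurable
    _ ≤ M ^ (1 - β) + ∑' k : ℕ, h * b * M ^ (1 - β) * (b * 2⁻¹) ^ k := by
        rw [mul_comm, hMM]
        gcongr with k
        exact hterm k
    _ = _ := by
        rw [ENNReal.tsum_mul_left, ENNReal.tsum_geometric]; ring

/-! ### The weighted norm inequality -/

/-- Tonelli's theorem and quasi-symmetry: up to the constant `a` the operator `f ↦ G(f dν)` is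
self-adjoint. -/
lemma lintegral_lintegral_kernel_le (hG : LowerSemicontinuous fun p : X × X => G p.1 p.2)
    {a : ℝ≥0} (hQ : ∀ x y, G x y ≤ a * G y x) (ν : Measure X) [SFinite ν]
    {f ψ : X → ℝ≥0∞} (hf : Measurable f) (hψ : Measurable ψ) :
    ∫⁻ x, (∫⁻ y, G x y * f y ∂ν) * ψ x ∂ν ≤ a * ∫⁻ y, f y * ∫⁻ x, G y x * ψ x ∂ν ∂ν := by
  have hGm : Measurable fun p : X × X => G p.1 p.2 := hG.measurable
  calc _ = ∫⁻ x, ∫⁻ y, G x y * f y * ψ x ∂ν ∂ν := by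
        refine lintegral_congr fun x => ?_
        have hm : Measurable fun y => G x y * f y := (measurable_kernel_left hG x).mul hf
        rw [lintegral_mul_const _ hm]
    _ = ∫⁻ y, ∫⁻ x, G x y * f y * ψ x ∂ν ∂ν := by
        refine lintegral_lintegral_swap (Measurable.aemeasurable ?_)
        exact (hGm.mul (hf.comp measurable_snd)).mul (hψ.comp measurable_fst)
    _ ≤ ∫⁻ y, ∫⁻ x, (a * f y) * (G y x * ψ x) ∂ν ∂ν := by
        refine lintegral_mono fun y => lintegral_mono fun x => ?_
        calc G x y * f y * ψ x ≤ a * G y x * f y * ψ x := by gcongr; exact hQ x y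
          _ = _ := by ring
    _ = ∫⁻ y, a * (f y * ∫⁻ x, G y x * ψ x ∂ν) ∂ν := by
        refine lintegral_congr fun y => ?_
        have hm : Measurable fun x => G y x * ψ x := (measurable_kernel_left hG y).mul hψ
        rw [lintegral_const_mul _ hm, mul_assoc]
    _ = _ := lintegral_const_mul' _ _ (by simp)

/-- The bound `L^(r/q)(σ) → L^r(σ)` for `f ↦ G(f dσ)` when `q < r < 1`. -/
lemma strong_type_of_lt_one (hG : LowerSemicontinuous fun p : X × X => G p.1 p.2)
    (hpos : ∀ x y, 0 < G x y) {h : ℝ≥0} (hW : WeakMaximumPrinciple G h)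
    {a : ℝ≥0} (hQ : ∀ x y, G x y ≤ a * G y x) {σ : Measure X} [SFinite σ] (hσ : σ ≠ 0)
    {q r : ℝ} (hq : 0 < q) (hqr : q < r) (hr : r < 1)
    (hB : ∫⁻ x, potential G σ x ^ (r / (1 - q)) ∂σ ≠ ∞) :
    ∃ C : ℝ≥0∞, C ≠ ∞ ∧ ∀ f : X → ℝ≥0∞, Measurable f →
      ∫⁻ x, (∫⁻ y, G x y * f y ∂σ) ^ r ∂σ ≤ C * (∫⁻ x, f x ^ (r / q) ∂σ) ^ q := by
  have hr0 : 0 < r := hq.trans hqr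
  have h1q : 0 < 1 - q := by linarith
  have hGm : Measurable fun p : X × X => G p.1 p.2 := hG.measurable
  set w := potential G σ with hw
  have hwm : Measurable w := measurable_potential hG σ
  have hw0 : ∀ x, w x ≠ 0 := fun x => (potential_pos hG hpos hσ x).ne'
  set B := ∫⁻ x, w x ^ (r / (1 - q)) ∂σ with hBdef
  have hwt : ∀ᵐ x ∂σ, w x ≠ ∞ := by
    have := ae_lt_top (hwm.pow_const (r / (1 - q))) hB
    filter_upwards [this] with x hx hx'
    rw [hx', ENNReal.top_rpow_of_pos (by positivity)] at hx
    exact lt_irrefl _ hx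
  -- This exponent satisfies `β r / (1 - r) = r / (1 - q)`, so both Hölder steps below produce `B`.
  set β := (1 - r) / (1 - q) with hβdef
  have hβ0 : 0 ≤ β := div_nonneg (by linarith) h1q.le
  have hβ1 : β < 1 := by rw [hβdef, div_lt_one h1q]; linarith
  obtain ⟨C, hC, hCle⟩ := exists_lintegral_kernel_mul_rpow_neg_le hG hpos hW hσ hβ0 hβ1
  refine ⟨(a * C) ^ r * B ^ (1 - q), ?_, fun f hf => ?_⟩
  · exact ENNReal.mul_ne_top (ENNReal.rpow_ne_top_of_nonneg hr0.le
      (ENNReal.mul_ne_top (by simp) hC)) (ENNReal.rpow_ne_top_of_nonneg h1q.le hB)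
  set F := ∫⁻ x, f x ^ (r / q) ∂σ with hF
  set u : X → ℝ≥0∞ := fun x => ∫⁻ y, G x y * f y ∂σ with hu
  have hum : Measurable u := (hGm.mul (hf.comp measurable_snd)).lintegral_prod_right'
  have hA : ∫⁻ x, u x * w x ^ (-β) ∂σ ≤ a * C * (F ^ (q / r) * B ^ (1 - q / r)) := by
    calc ∫⁻ x, u x * w x ^ (-β) ∂σ ≤ a * ∫⁻ y, f y * ∫⁻ x, G y x * w x ^ (-β) ∂σ ∂σ :=
          lintegral_lintegral_kernel_le hG hQ σ hf (hwm.pow_const _)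
      _ ≤ a * ∫⁻ y, C * (f y * w y ^ (1 - β)) ∂σ := by
          refine mul_le_mul_right (lintegral_mono fun y => ?_) _
          calc _ ≤ f y * (C * w y ^ (1 - β)) := mul_le_mul_right (hCle y) _
            _ = _ := by ring
      _ = a * C * ∫⁻ y, f y * w y ^ (1 - β) ∂σ := by
          have hm : Measurable fun y => f y * w y ^ (1 - β) := hf.mul (hwm.pow_const _)
          rw [lintegral_const_mul _ hm, mul_assoc]
      _ = a * C * ∫⁻ y, (f y ^ (r / q)) ^ (q / r) *
            (w y ^ (r / (1 - q))) ^ (1 - q / r) ∂σ := by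
          congr 1
          refine lintegral_congr fun y => ?_
          rw [← ENNReal.rpow_mul, ← ENNReal.rpow_mul]
          have e1 : r / q * (q / r) = 1 := by field_simp
          have e2 : r / (1 - q) * (1 - q / r) = 1 - β := by rw [hβdef]; field_simp; ring
          rw [e1, e2, ENNReal.rpow_one]
      _ ≤ _ := by
          gcongr
          refine ENNReal.lintegral_mul_norm_pow_le (hf.pow_const _).aemeasurable
            (hwm.pow_const _).aemeasurable (by positivity) ?_ (by ring)
          rw [sub_nonneg, div_le_one hr0]; exact hqr.le
  calc ∫⁻ x, u x ^ r ∂σ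
      = ∫⁻ x, (u x * w x ^ (-β)) ^ r * (w x ^ (r / (1 - q))) ^ (1 - r) ∂σ := by
        refine lintegral_congr_ae ?_
        -- Where `w = ∞` the factor `w ^ (-β)` is `0`, so the identity holds only almost everywhere.
        filter_upwards [hwt] with x hx
        rw [ENNReal.mul_rpow_of_nonneg _ _ hr0.le, ← ENNReal.rpow_mul, ← ENNReal.rpow_mul, mul_assoc,
          ← ENNReal.rpow_add _ _ (hw0 x) hx]
        have : -β * r + r / (1 - q) * (1 - r) = 0 := by rw [hβdef]; field_simp; ring
        rw [this, ENNReal.rpow_zero, mul_one]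
    _ ≤ (∫⁻ x, u x * w x ^ (-β) ∂σ) ^ r * B ^ (1 - r) :=
        ENNReal.lintegral_mul_norm_pow_le (hum.mul (hwm.pow_const _)).aemeasurable
          (hwm.pow_const _).aemeasurable hr0.le (by linarith) (by ring)
    _ ≤ (a * C * (F ^ (q / r) * B ^ (1 - q / r))) ^ r * B ^ (1 - r) := by gcongr
    _ = _ := by
        rw [ENNReal.mul_rpow_of_nonneg _ _ hr0.le, ENNReal.mul_rpow_of_nonneg (F ^ _) _ hr0.le,
          ← ENNReal.rpow_mul, ← ENNReal.rpow_mul]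
        have e1 : q / r * r = q := by field_simp
        have e2 : (1 - q / r) * r = r - q := by field_simp
        have e3 : B ^ (1 - q) = B ^ (r - q) * B ^ (1 - r) := by
          rw [← ENNReal.rpow_add_of_nonneg _ _ (by linarith) (by linarith)]; congr 1; ring
        rw [e1, e2, e3]; ring

/-- The case `r ≥ 1` for a finite measure and truncated potentials. The truncation makes the
left-hand side finite, which is needed to absorb a power of it; the constant does not depend on
the truncation height. -/
lemma strong_type_truncated (hG : LowerSemicontinuous fun p : X × X => G p.1 p.2)
    (hpos : ∀ x y, 0 < G x y) {h : ℝ≥0} (h1 : 1 ≤ h) (hW : WeakMaximumPrinciple G h)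
    {a : ℝ≥0} (hQ : ∀ x y, G x y ≤ a * G y x) (ν : Measure X) [IsFiniteMeasure ν]
    {q r : ℝ} (hq : 0 < q) (hq1 : q < 1) (hr : 1 ≤ r) {f : X → ℝ≥0∞} (hf : Measurable f)
    (N : ℝ≥0) :
    ∫⁻ x, min (∫⁻ y, G x y * f y ∂ν) N ^ r ∂ν ≤ (2 * (2 * (h : ℝ≥0∞)) ^ (r - 1) * a) ^ r *
      (∫⁻ x, potential G ν x ^ (r / (1 - q)) ∂ν) ^ (1 - q) * (∫⁻ x, f x ^ (r / q) ∂ν) ^ q := by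
  have hr0 : 0 < r := by linarith
  have h1q : 0 < 1 - q := by linarith
  have hGm : Measurable fun p : X × X => G p.1 p.2 := hG.measurable
  set w := potential G ν with hw
  have hwm : Measurable w := measurable_potential hG ν
  set c : ℝ≥0∞ := 2 * (2 * (h : ℝ≥0∞)) ^ (r - 1) with hc
  have hgeq : ∀ x, potential G (ν.withDensity f) x = ∫⁻ y, G x y * f y ∂ν :=
    potential_withDensity hG ν hf
  set m : X → ℝ≥0∞ := fun x => min (∫⁻ y, G x y * f y ∂ν) N with hm
  have hmm : Measurable m := by
    have : Measurable fun x => ∫⁻ y, G x y * f y ∂ν :=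
      (hGm.mul (hf.comp measurable_snd)).lintegral_prod_right'
    exact this.min measurable_const
  set B := ∫⁻ x, w x ^ (r / (1 - q)) ∂ν with hB
  set F := ∫⁻ x, f x ^ (r / q) ∂ν with hF
  set A := ∫⁻ x, m x ^ r ∂ν with hA
  have hAt : A ≠ ∞ := by
    have : A ≤ ∫⁻ _, (N : ℝ≥0∞) ^ r ∂ν := by
      refine lintegral_mono fun x => ?_
      dsimp only
      gcongr; exact min_le_right _ _
    rw [lintegral_const] at this
    exact ne_top_of_le_ne_top (ENNReal.mul_ne_top
      (ENNReal.rpow_ne_top_of_nonneg hr0.le (by simp)) (measure_ne_top _ _)) this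
  have hit : ∀ x, m x ^ r ≤ c * ∫⁻ y, G x y * (f y * m y ^ (r - 1)) ∂ν := by
    intro x
    have := min_potential_rpow_le hG hpos h1 hW (ν.withDensity f) hr N x
    simp only [hgeq] at this
    have hGmm : Measurable fun y => G x y * m y ^ (r - 1) :=
      (measurable_kernel_left hG x).mul (hmm.pow_const _)
    rw [lintegral_withDensity_eq_lintegral_mul _ hf hGmm] at this
    refine this.trans (le_of_eq ?_)
    congr 1
    refine lintegral_congr fun y => ?_
    simp only [Pi.mul_apply]; ring
  have hAle : A ≤ c * a * (B ^ ((1 - q) / r) * F ^ (q / r) * A ^ ((r - 1) / r)) := by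
    have hfm : Measurable fun y => f y * m y ^ (r - 1) := hf.mul (hmm.pow_const _)
    calc A ≤ ∫⁻ x, c * ((∫⁻ y, G x y * (f y * m y ^ (r - 1)) ∂ν) * 1) ∂ν := by
          refine lintegral_mono fun x => ?_
          dsimp only
          rw [mul_one]; exact hit x
      _ = c * ∫⁻ x, (∫⁻ y, G x y * (f y * m y ^ (r - 1)) ∂ν) * 1 ∂ν := by
          refine lintegral_const_mul _ (Measurable.mul_const ?_ _)
          exact (hGm.mul (hfm.comp measurable_snd)).lintegral_prod_right'
      _ ≤ c * (a * ∫⁻ y, f y * m y ^ (r - 1) * ∫⁻ x, G y x * 1 ∂ν ∂ν) := by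
          gcongr
          exact lintegral_lintegral_kernel_le hG hQ ν hfm measurable_const
      _ = c * a * ∫⁻ y, (w y ^ (r / (1 - q))) ^ ((1 - q) / r) * (f y ^ (r / q)) ^ (q / r) *
            (m y ^ r) ^ ((r - 1) / r) ∂ν := by
          rw [mul_assoc c]
          congr 2
          refine lintegral_congr fun y => ?_
          rw [← ENNReal.rpow_mul, ← ENNReal.rpow_mul, ← ENNReal.rpow_mul]
          have e1 : r / (1 - q) * ((1 - q) / r) = 1 := by field_simp
          have e2 : r / q * (q / r) = 1 := by field_simp
          have e3 : r * ((r - 1) / r) = r - 1 := by field_simp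
          rw [e1, e2, e3, ENNReal.rpow_one, ENNReal.rpow_one]
          simp only [mul_one]
          change f y * m y ^ (r - 1) * w y = _
          ring
      _ ≤ _ := by
          gcongr
          refine lintegral_mul_rpow_mul_rpow_mul_rpow_le (hwm.pow_const _).aemeasurable
            (hf.pow_const _).aemeasurable (hmm.pow_const _).aemeasurable (by positivity)
            (by positivity) (div_nonneg (by linarith) hr0.le) ?_
          field_simp; ring
  rcases eq_or_ne A 0 with hA0 | hA0
  · rw [hA0]; exact zero_le
  have hroot : A ^ r⁻¹ ≤ c * a * (B ^ ((1 - q) / r) * F ^ (q / r)) := by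
    have hA1 : A ^ ((r - 1) / r) ≠ 0 := by
      simp [ENNReal.rpow_eq_zero_iff, hA0, hAt]
    have hA2 : A ^ ((r - 1) / r) ≠ ∞ :=
      ENNReal.rpow_ne_top_of_nonneg (div_nonneg (by linarith) hr0.le) hAt
    refine (ENNReal.mul_le_mul_iff_left hA1 hA2).1 ?_
    rw [← ENNReal.rpow_add _ _ hA0 hAt]
    have : r⁻¹ + (r - 1) / r = 1 := by field_simp; ring
    rw [this, ENNReal.rpow_one]
    calc A ≤ _ := hAle
      _ = _ := by ring
  calc A = (A ^ r⁻¹) ^ r := by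
        rw [← ENNReal.rpow_mul, inv_mul_cancel₀ hr0.ne', ENNReal.rpow_one]
    _ ≤ (c * a * (B ^ ((1 - q) / r) * F ^ (q / r))) ^ r := by gcongr
    _ = _ := by
        rw [ENNReal.mul_rpow_of_nonneg _ _ hr0.le, ENNReal.mul_rpow_of_nonneg (B ^ _) _ hr0.le,
          ← ENNReal.rpow_mul, ← ENNReal.rpow_mul, div_mul_cancel₀ _ hr0.ne',
          div_mul_cancel₀ _ hr0.ne', ← mul_assoc]

/-- The bound `L^(r/q)(σ) → L^r(σ)` for `f ↦ G(f dσ)` when `r ≥ 1`, obtained from the truncated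
version by exhausting the space with sets of finite measure and applying Fatou's lemma. -/
lemma strong_type_of_one_le (hG : LowerSemicontinuous fun p : X × X => G p.1 p.2)
    (hpos : ∀ x y, 0 < G x y) {h : ℝ≥0} (h1 : 1 ≤ h) (hW : WeakMaximumPrinciple G h)
    {a : ℝ≥0} (hQ : ∀ x y, G x y ≤ a * G y x) {σ : Measure X} [SigmaFinite σ]
    {q r : ℝ} (hq : 0 < q) (hq1 : q < 1) (hr : 1 ≤ r)
    (hB : ∫⁻ x, potential G σ x ^ (r / (1 - q)) ∂σ ≠ ∞) :
    ∃ C : ℝ≥0∞, C ≠ ∞ ∧ ∀ f : X → ℝ≥0∞, Measurable f →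
      ∫⁻ x, (∫⁻ y, G x y * f y ∂σ) ^ r ∂σ ≤ C * (∫⁻ x, f x ^ (r / q) ∂σ) ^ q := by
  have hr0 : 0 < r := by linarith
  have h1q : 0 < 1 - q := by linarith
  have hGm : Measurable fun p : X × X => G p.1 p.2 := hG.measurable
  refine ⟨(2 * (2 * (h : ℝ≥0∞)) ^ (r - 1) * a) ^ r *
      (∫⁻ x, potential G σ x ^ (r / (1 - q)) ∂σ) ^ (1 - q), ?_, fun f hf => ?_⟩
  · refine ENNReal.mul_ne_top (ENNReal.rpow_ne_top_of_nonneg hr0.le ?_)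
      (ENNReal.rpow_ne_top_of_nonneg h1q.le hB)
    refine ENNReal.mul_ne_top (ENNReal.mul_ne_top (by simp)
      (ENNReal.rpow_ne_top_of_nonneg (by linarith) ?_)) (by simp)
    exact ENNReal.mul_ne_top (by simp) (by simp)
  set K := spanningSets σ with hK
  have hKm : ∀ k, MeasurableSet (K k) := measurableSet_spanningSets σ
  set φ : ℕ → X → ℝ≥0∞ := fun k => (K k).indicator
    fun x => min (∫⁻ y in K k, G x y * f y ∂σ) ((k : ℝ≥0) : ℝ≥0∞) ^ r with hφ
  have hφm : ∀ k, Measurable (φ k) := fun k => by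
    have : Measurable fun x => ∫⁻ y in K k, G x y * f y ∂σ :=
      (hGm.mul (hf.comp measurable_snd)).lintegral_prod_right'
    exact ((this.min measurable_const).pow_const r).indicator (hKm k)
  have hlim : ∀ x, Tendsto (fun k => φ k x) atTop (𝓝 ((∫⁻ y, G x y * f y ∂σ) ^ r)) := by
    intro x
    have hmon : Monotone fun k => ∫⁻ y in K k, G x y * f y ∂σ := fun i j hij =>
      lintegral_mono_set (monotone_spanningSets σ hij)
    have hconv : Tendsto (fun k => ∫⁻ y in K k, G x y * f y ∂σ) atTop
        (𝓝 (∫⁻ y, G x y * f y ∂σ)) := by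
      have := tendsto_atTop_iSup hmon
      rwa [← setLIntegral_iUnion_of_directed _ (monotone_spanningSets σ).directed_le,
        iUnion_spanningSets, setLIntegral_univ] at this
    have hmin := hconv.min (ENNReal.tendsto_nat_nhds_top)
    rw [min_eq_left le_top] at hmin
    have hp := (ENNReal.continuous_rpow_const (y := r)).continuousAt.tendsto.comp hmin
    refine hp.congr' ?_
    filter_upwards [eventually_ge_atTop (spanningSetsIndex σ x)] with k hk
    have hx : x ∈ K k := monotone_spanningSets σ hk (mem_spanningSetsIndex σ x)
    simp [hφ, hx]
  calc ∫⁻ x, (∫⁻ y, G x y * f y ∂σ) ^ r ∂σ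
      = ∫⁻ x, liminf (fun k => φ k x) atTop ∂σ :=
        lintegral_congr fun x => ((hlim x).liminf_eq).symm
    _ ≤ liminf (fun k => ∫⁻ x, φ k x ∂σ) atTop := lintegral_liminf_le hφm
    _ ≤ _ := by
        refine liminf_le_of_frequently_le' (Eventually.of_forall fun k => ?_).frequently
        have : IsFiniteMeasure (σ.restrict (K k)) :=
          ⟨by simpa using measure_spanningSets_lt_top σ k⟩
        rw [lintegral_indicator (hKm k)]
        refine (strong_type_truncated hG hpos h1 hW hQ (σ.restrict (K k)) hq hq1 hr hf k).trans ?_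
        have hle : σ.restrict (K k) ≤ σ := Measure.restrict_le_self
        gcongr
        exact lintegral_mono' hle le_rfl

/-- If `Gσ ∈ L^(r/(1-q))(σ)` and `q < r`, then `f ↦ G(f dσ)` is bounded from `L^(r/q)(σ)` to
`L^r(σ)`. -/
lemma strong_type (hG : LowerSemicontinuous fun p : X × X => G p.1 p.2)
    (hpos : ∀ x y, 0 < G x y) {h : ℝ≥0} (h1 : 1 ≤ h) (hW : WeakMaximumPrinciple G h)
    {a : ℝ≥0} (hQ : ∀ x y, G x y ≤ a * G y x) {σ : Measure X} [SigmaFinite σ] (hσ : σ ≠ 0)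
    {q r : ℝ} (hq : 0 < q) (hq1 : q < 1) (hqr : q < r)
    (hB : ∫⁻ x, potential G σ x ^ (r / (1 - q)) ∂σ ≠ ∞) :
    ∃ C : ℝ≥0∞, C ≠ ∞ ∧ ∀ f : X → ℝ≥0∞, Measurable f →
      ∫⁻ x, (∫⁻ y, G x y * f y ∂σ) ^ r ∂σ ≤ C * (∫⁻ x, f x ^ (r / q) ∂σ) ^ q := by
  rcases lt_or_ge r 1 with hr | hr
  · exact strong_type_of_lt_one hG hpos hW hQ hσ hq hqr hr hB
  · exact strong_type_of_one_le hG hpos h1 hW hQ hq hq1 hr hB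

/-! ### Lower bounds for supersolutions -/

/-- The lower bound for supersolutions, for `σ` restricted to the set where `1/k ≤ u ≤ k`. The
constant on the right does not depend on `k`. -/
lemma potential_restrict_rpow_le_of_supersolution
    (hG : LowerSemicontinuous fun p : X × X => G p.1 p.2)
    (hpos : ∀ x y, 0 < G x y) {h : ℝ≥0} (h1 : 1 ≤ h) (hW : WeakMaximumPrinciple G h)
    {q : ℝ} (hq : 0 < q) (hq1 : q < 1) (σ : Measure X) {u : X → ℝ≥0∞} (hu : Measurable u)
    (hsup : ∀ x, ∫⁻ y, G x y * u y ^ q ∂σ ≤ u x) {k : ℝ≥0} (hk : 1 ≤ k) (x : X) :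
    potential G (σ.restrict {y | 1 ≤ k * u y ∧ u y ≤ k}) x ^ (1 / (1 - q)) ≤
      (2 * (2 * (h : ℝ≥0∞)) ^ (1 / (1 - q) - 1)) ^ (1 / (1 - q)) * u x := by
  have h1q : 0 < 1 - q := by linarith
  set s := 1 / (1 - q) with hs
  have hs1 : 1 < s := by rw [hs, lt_div_iff₀ h1q]; linarith
  have hs0 : 0 < s := by linarith
  have hqs : s - 1 = s * q := by rw [hs]; field_simp; ring
  set c : ℝ≥0∞ := 2 * (2 * (h : ℝ≥0∞)) ^ (s - 1) with hc
  have hc1 : 1 ≤ c := by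
    have h2 : (1 : ℝ≥0∞) ≤ 2 * h :=
      one_le_mul_of_one_le_of_one_le (by norm_num) (by exact_mod_cast h1)
    exact one_le_mul_of_one_le_of_one_le (by norm_num)
      (ENNReal.one_le_rpow h2 (by linarith))
  have hc0 : c ≠ 0 := (zero_lt_one.trans_le hc1).ne'
  have hct : c ≠ ∞ := ENNReal.mul_ne_top (by simp)
    (ENNReal.rpow_ne_top_of_nonneg (by linarith) (ENNReal.mul_ne_top (by simp) (by simp)))
  set B := {y | 1 ≤ k * u y ∧ u y ≤ k} with hB
  have hBm : MeasurableSet B :=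
    (measurableSet_le measurable_const (hu.const_mul _)).inter
      (measurableSet_le hu measurable_const)
  set g := potential G (σ.restrict B) with hg
  have hGm := fun z => measurable_kernel_left hG z
  have hGu : ∀ z, Measurable fun y => G z y * u y ^ q := fun z => (hGm z).mul (hu.pow_const q)
  -- One application of the iterated inequality replaces the constant `E` by `c * E ^ q`.
  have step : ∀ E : ℝ≥0∞, (∀ y ∈ B, g y ^ s ≤ E * u y) →
      ∀ z, g z ^ s ≤ c * E ^ q * u z := by
    intro E hE z
    calc g z ^ s ≤ c * ∫⁻ y in B, G z y * g y ^ (s - 1) ∂σ :=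
          potential_rpow_le hG hpos h1 hW (σ.restrict B) hs1.le z
      _ ≤ c * ∫⁻ y in B, E ^ q * (G z y * u y ^ q) ∂σ := by
          refine mul_le_mul_right (setLIntegral_mono' hBm fun y hy => ?_) _
          calc G z y * g y ^ (s - 1) = G z y * (g y ^ s) ^ q := by
                rw [hqs, ENNReal.rpow_mul]
            _ ≤ G z y * (E * u y) ^ q :=
                mul_le_mul_right (ENNReal.rpow_le_rpow (hE y hy) hq.le) _
            _ = _ := by rw [ENNReal.mul_rpow_of_nonneg _ _ hq.le]; ring
      _ = c * E ^ q * ∫⁻ y in B, G z y * u y ^ q ∂σ := by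
          rw [lintegral_const_mul _ (hGu z), mul_assoc c]
      _ ≤ c * E ^ q * u z :=
          mul_le_mul_right ((setLIntegral_le_lintegral _ _).trans (hsup z)) _
  set D : ℝ≥0 := k ^ ((q + 1) * s) * k with hD
  have hk0 : k ≠ 0 := (zero_lt_one.trans_le hk).ne'
  have hD0 : D ≠ 0 := by
    rw [hD]; exact mul_ne_zero (by simp [NNReal.rpow_eq_zero_iff, hk0]) hk0
  -- On `B` the potential `g` is at most `k ^ (q + 1)`, since `1 ≤ k * u` there and `u ≤ k`.
  have start : ∀ y ∈ B, g y ^ s ≤ D * u y := by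
    intro y hy
    have hgy : g y ≤ (k : ℝ≥0∞) ^ (q + 1) := by
      calc g y ≤ ∫⁻ z in B, (k : ℝ≥0∞) ^ q * (G y z * u z ^ q) ∂σ := by
            refine setLIntegral_mono' hBm fun z hz => ?_
            calc G y z = G y z * 1 := (mul_one _).symm
              _ ≤ G y z * (k * u z) ^ q :=
                  mul_le_mul_right (ENNReal.one_le_rpow hz.1 hq) _
              _ = _ := by rw [ENNReal.mul_rpow_of_nonneg _ _ hq.le]; ring
        _ = (k : ℝ≥0∞) ^ q * ∫⁻ z in B, G y z * u z ^ q ∂σ := lintegral_const_mul _ (hGu y)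
        _ ≤ (k : ℝ≥0∞) ^ q * k :=
            mul_le_mul_right (((setLIntegral_le_lintegral _ _).trans (hsup y)).trans hy.2) _
        _ = _ := by
            rw [ENNReal.rpow_add_of_nonneg _ _ hq.le zero_le_one, ENNReal.rpow_one]
    calc g y ^ s ≤ ((k : ℝ≥0∞) ^ (q + 1)) ^ s := ENNReal.rpow_le_rpow hgy hs0.le
      _ = (k : ℝ≥0∞) ^ ((q + 1) * s) * 1 := by rw [← ENNReal.rpow_mul, mul_one]
      _ ≤ (k : ℝ≥0∞) ^ ((q + 1) * s) * (k * u y) := mul_le_mul_right hy.1 _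
      _ = D * u y := by
          rw [hD, ENNReal.coe_mul, ENNReal.coe_rpow_of_nonneg _ (by positivity), mul_assoc]
  have iter : ∀ j : ℕ, ∀ y ∈ B, g y ^ s ≤ c ^ s * (D : ℝ≥0∞) ^ (q ^ j) * u y := by
    intro j
    induction j with
    | zero =>
      intro y hy
      rw [pow_zero, ENNReal.rpow_one, mul_assoc]
      exact (start y hy).trans (le_mul_of_one_le_left' (ENNReal.one_le_rpow hc1 hs0))
    | succ j ih =>
      intro y _
      refine (step _ ih y).trans (le_of_eq ?_)
      rw [ENNReal.mul_rpow_of_nonneg _ _ hq.le, ← ENNReal.rpow_mul, ← ENNReal.rpow_mul, ← hqs,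
        ← pow_succ, ← mul_assoc]
      congr 2
      nth_rewrite 1 [← ENNReal.rpow_one c]
      rw [← ENNReal.rpow_add _ _ hc0 hct]
      congr 1; ring
  have hcs0 : c ^ s ≠ 0 := by simp [ENNReal.rpow_eq_zero_iff, hc0, hct]
  have hDlim : Tendsto (fun j : ℕ => (D : ℝ≥0∞) ^ (q ^ j)) atTop (𝓝 1) := by
    have h3 : Tendsto (fun j : ℕ => D ^ (q ^ j)) atTop (𝓝 (D ^ (0 : ℝ))) :=
      tendsto_const_nhds.nnrpow (tendsto_pow_atTop_nhds_zero_of_lt_one hq.le hq1) (Or.inl hD0)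
    rw [NNReal.rpow_zero] at h3
    have h4 := ENNReal.tendsto_coe.2 h3
    simpa only [ENNReal.coe_rpow_of_ne_zero hD0, ENNReal.coe_one] using h4
  -- The factor `D ^ (q ^ j)` tends to `1`, which leaves the fixed point `c ^ s` of `E ↦ c * E ^ q`.
  have fin : ∀ y ∈ B, g y ^ s ≤ c ^ s * u y := by
    intro y hy
    have h5 : Tendsto (fun j : ℕ => c ^ s * (D : ℝ≥0∞) ^ (q ^ j) * u y) atTop
        (𝓝 (c ^ s * 1 * u y)) :=
      ENNReal.Tendsto.mul_const (ENNReal.Tendsto.const_mul hDlim (Or.inl one_ne_zero))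
        (Or.inl (by simpa using hcs0))
    rw [mul_one] at h5
    exact ge_of_tendsto' h5 fun j => iter j y hy
  refine (step _ fin x).trans (le_of_eq ?_)
  rw [← ENNReal.rpow_mul, ← hqs]
  congr 1
  nth_rewrite 1 [← ENNReal.rpow_one c]
  rw [← ENNReal.rpow_add _ _ hc0 hct]
  congr 1; ring

/-- Every positive supersolution dominates a multiple of `(Gσ)^(1/(1-q))`. -/
lemma potential_rpow_le_of_supersolution
    (hG : LowerSemicontinuous fun p : X × X => G p.1 p.2)
    (hpos : ∀ x y, 0 < G x y) {h : ℝ≥0} (h1 : 1 ≤ h) (hW : WeakMaximumPrinciple G h)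
    {q : ℝ} (hq : 0 < q) (hq1 : q < 1) (σ : Measure X) {u : X → ℝ≥0∞} (hu : Measurable u)
    (hu0 : ∀ x, 0 < u x) (hut : ∀ᵐ x ∂σ, u x < ∞)
    (hsup : ∀ x, ∫⁻ y, G x y * u y ^ q ∂σ ≤ u x) (x : X) :
    potential G σ x ^ (1 / (1 - q)) ≤
      (2 * (2 * (h : ℝ≥0∞)) ^ (1 / (1 - q) - 1)) ^ (1 / (1 - q)) * u x := by
  set K : ℕ → Set X := fun n =>
    {y | 1 ≤ ((n + 1 : ℝ≥0) : ℝ≥0∞) * u y ∧ u y ≤ ((n + 1 : ℝ≥0) : ℝ≥0∞)} with hK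
  have hmono : Monotone K := by
    intro i j hij y hy
    have hle : ((i + 1 : ℝ≥0) : ℝ≥0∞) ≤ ((j + 1 : ℝ≥0) : ℝ≥0∞) := by
      have : (i : ℝ≥0) ≤ j := by exact_mod_cast hij
      exact ENNReal.coe_le_coe.2 (by gcongr)
    exact ⟨hy.1.trans (mul_le_mul_left hle _), hy.2.trans hle⟩
  have hunion : ∀ᵐ y ∂σ, y ∈ ⋃ n, K n := by
    filter_upwards [hut] with y hy
    obtain ⟨n, hn⟩ := ENNReal.exists_nat_gt hy.ne
    obtain ⟨m, hm⟩ := ENNReal.exists_nat_gt (ENNReal.inv_ne_top.2 (hu0 y).ne')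
    have hle : ∀ i : ℕ, i ≤ max n m → (i : ℝ≥0∞) ≤ (((max n m : ℕ) + 1 : ℝ≥0) : ℝ≥0∞) := by
      intro i hi
      have : (i : ℝ≥0) ≤ (max n m : ℕ) + 1 := by exact_mod_cast hi.trans (Nat.le_succ _)
      exact_mod_cast this
    refine mem_iUnion.2 ⟨max n m, ?_, hn.le.trans (hle n (le_max_left _ _))⟩
    rw [← ENNReal.inv_mul_cancel (hu0 y).ne' hy.ne]
    exact mul_le_mul_left (hm.le.trans (hle m (le_max_right _ _))) _
  have hlim : Tendsto (fun n => potential G (σ.restrict (K n)) x) atTop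
      (𝓝 (potential G σ x)) := by
    have hm : Monotone fun n => potential G (σ.restrict (K n)) x := fun i j hij =>
      lintegral_mono_set (hmono hij)
    have := tendsto_atTop_iSup hm
    simp only [potential] at this
    rwa [← setLIntegral_iUnion_of_directed _ hmono.directed_le,
      Measure.restrict_eq_self_of_ae_mem hunion] at this
  have hlim' := (ENNReal.continuous_rpow_const (y := 1 / (1 - q))).continuousAt.tendsto.comp hlim
  exact le_of_tendsto' hlim' fun n =>
    potential_restrict_rpow_le_of_supersolution hG hpos h1 hW hq hq1 σ hu hsup
      (le_add_self : (1 : ℝ≥0) ≤ n + 1) x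

lemma measurable_solutionOperator (hG : LowerSemicontinuous fun p : X × X => G p.1 p.2) (q : ℝ)
    (σ μ : Measure X) (u : X → ℝ≥0∞) : Measurable (solutionOperator G q σ μ u) :=
  (measurable_potential hG _).add (measurable_potential hG _)

/-! ### Construction of solutions by monotone iteration -/

/-- With `c` the constant of the iterated inequality for the exponent `1/(1-q)`, the choice
`κ = c^(-1/(1-q))` satisfies `κ c = κ^q` and makes `κ (Gσ)^(1/(1-q))` a subsolution. -/
lemma exists_subsolution (hG : LowerSemicontinuous fun p : X × X => G p.1 p.2)
    (hpos : ∀ x y, 0 < G x y) {h : ℝ≥0} (h1 : 1 ≤ h) (hW : WeakMaximumPrinciple G h)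
    {q : ℝ} (hq : 0 < q) (hq1 : q < 1) (σ μ : Measure X) :
    ∃ κ : ℝ≥0, 0 < κ ∧ (fun x => (κ : ℝ≥0∞) * potential G σ x ^ (1 / (1 - q))) ≤
      solutionOperator G q σ μ fun x => (κ : ℝ≥0∞) * potential G σ x ^ (1 / (1 - q)) := by
  have h1q : 0 < 1 - q := by linarith
  set s := 1 / (1 - q) with hs
  have hs1 : 1 ≤ s := by rw [hs, le_div_iff₀ h1q]; linarith
  have hqs : s - 1 = s * q := by rw [hs]; field_simp; ring
  have hh : h ≠ 0 := (zero_lt_one.trans_le h1).ne'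
  set c : ℝ≥0 := 2 * (2 * h) ^ (s - 1) with hc
  have hc0 : c ≠ 0 := mul_ne_zero two_ne_zero (by simp [NNReal.rpow_eq_zero_iff, hh])
  set κ : ℝ≥0 := c ^ (-s) with hκ
  have hκc : κ * c = κ ^ q := by
    nth_rewrite 1 [← NNReal.rpow_one c]
    rw [hκ, ← NNReal.rpow_add hc0, ← NNReal.rpow_mul]
    congr 1; linarith
  refine ⟨κ, NNReal.rpow_pos (pos_iff_ne_zero.2 hc0), fun x => ?_⟩
  have hwm := measurable_potential hG σ
  have hm : Measurable fun y => G x y * potential G σ y ^ (s - 1) :=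
    (measurable_kernel_left hG x).mul (hwm.pow_const _)
  rw [solutionOperator_apply hG q σ μ ((hwm.pow_const s).const_mul _)]
  refine le_trans ?_ le_self_add
  calc (κ : ℝ≥0∞) * potential G σ x ^ s
      ≤ κ * (c * ∫⁻ y, G x y * potential G σ y ^ (s - 1) ∂σ) := by
        refine mul_le_mul_right ((potential_rpow_le hG hpos h1 hW σ hs1 x).trans (le_of_eq ?_)) _
        rw [hc, ENNReal.coe_mul, ENNReal.coe_rpow_of_nonneg _ (by linarith)]
        norm_cast
    _ = (κ : ℝ≥0∞) ^ q * ∫⁻ y, G x y * potential G σ y ^ (s - 1) ∂σ := by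
        rw [← mul_assoc, ← ENNReal.coe_mul, hκc, ENNReal.coe_rpow_of_nonneg _ hq.le]
    _ = ∫⁻ y, (κ : ℝ≥0∞) ^ q * (G x y * potential G σ y ^ (s - 1)) ∂σ :=
        (lintegral_const_mul _ hm).symm
    _ = _ := by
        refine lintegral_congr fun y => ?_
        rw [ENNReal.mul_rpow_of_nonneg _ _ hq.le, ← ENNReal.rpow_mul, ← hqs]; ring

/-- Iterating the solution operator from a positive subsolution in `L^r(σ)` produces a solution in
`L^r(σ)`, provided that `f ↦ G(f dσ)` is bounded from `L^(r/q)(σ)` to `L^r(σ)`. -/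
lemma exists_solution_of_le_solutionOperator
    (hG : LowerSemicontinuous fun p : X × X => G p.1 p.2) {q r : ℝ} (hq : 0 < q) (hq1 : q < 1)
    (hqr : q < r) {σ μ : Measure X} [IsLocallyFiniteMeasure σ] {C : ℝ≥0∞} (hC : C ≠ ∞)
    (hstrong : ∀ f : X → ℝ≥0∞, Measurable f →
      ∫⁻ x, (∫⁻ y, G x y * f y ∂σ) ^ r ∂σ ≤ C * (∫⁻ x, f x ^ (r / q) ∂σ) ^ q)
    (hμ : ∫⁻ x, potential G μ x ^ r ∂σ ≠ ∞) {v₀ : X → ℝ≥0∞} (hv₀ : Measurable v₀)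
    (hv₀0 : ∀ x, 0 < v₀ x) (hv₀r : ∫⁻ x, v₀ x ^ r ∂σ ≠ ∞)
    (hle : v₀ ≤ solutionOperator G q σ μ v₀) :
    ∃ (u : X → ℝ≥0∞) (v : ℕ → X → ℝ≥0∞), IsPositiveSolution G q σ μ u ∧
      MemLp u (ENNReal.ofReal r) σ ∧ v 0 = v₀ ∧
      (∀ j x, v (j + 1) x = solutionOperator G q σ μ (v j) x) ∧ Monotone v ∧
      ∀ x, u x = ⨆ j, v j x := by
  have hr : 0 < r := hq.trans hqr
  set v : ℕ → X → ℝ≥0∞ := fun j => (solutionOperator G q σ μ)^[j] v₀ with hv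
  have hsucc : ∀ j, v (j + 1) = solutionOperator G q σ μ (v j) := fun j =>
    Function.iterate_succ_apply' _ _ _
  have hvm : ∀ j, Measurable (v j) := by
    rintro (_ | j)
    · exact hv₀
    · rw [hsucc]; exact measurable_solutionOperator hG q σ μ _
  have hmono : Monotone v := (monotone_solutionOperator G hq.le σ μ).monotone_iterate_of_le_map hle
  set u : X → ℝ≥0∞ := fun x => ⨆ j, v j x with hu
  have hum : Measurable u := Measurable.iSup hvm
  set κ := ENNReal.LpAddConst (ENNReal.ofReal r)⁻¹ with hκ
  have hκt : κ ≠ ∞ := (ENNReal.LpAddConst_lt_top _).ne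
  set D := ∫⁻ x, potential G μ x ^ r ∂σ with hD
  have hrec : ∀ j, ∫⁻ x, v (j + 1) x ^ r ∂σ ≤
      κ * (C + D) * ((∫⁻ x, v j x ^ r ∂σ) ^ q + 1) := by
    intro j
    have hf := hstrong (fun y => v j y ^ q) ((hvm j).pow_const q)
    have he : ∀ y, (v j y ^ q) ^ (r / q) = v j y ^ r := fun y => by
      rw [← ENNReal.rpow_mul]; congr 1; field_simp
    simp only [he] at hf
    calc ∫⁻ x, v (j + 1) x ^ r ∂σ
        ≤ ∫⁻ x, κ * ((∫⁻ y, G x y * v j y ^ q ∂σ) ^ r + potential G μ x ^ r) ∂σ := by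
          refine lintegral_mono fun x => ?_
          dsimp only
          rw [hsucc, solutionOperator_apply hG q σ μ (hvm j)]
          exact ENNReal.rpow_add_le_mul_rpow_add_rpow' _ _ hr.le
      _ = κ * (∫⁻ x, (∫⁻ y, G x y * v j y ^ q ∂σ) ^ r ∂σ + D) := by
          rw [lintegral_const_mul' _ _ hκt,
            lintegral_add_right _ ((measurable_potential hG μ).pow_const r)]
      _ ≤ κ * (C * (∫⁻ x, v j x ^ r ∂σ) ^ q + D) := by gcongr
      _ ≤ κ * ((C + D) * (∫⁻ x, v j x ^ r ∂σ) ^ q + (C + D) * 1) := by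
          gcongr
          · exact le_self_add
          · rw [mul_one]; exact le_add_self
      _ = _ := by ring
  obtain ⟨L, hL, hIL⟩ := exists_bound_of_sublinear_recursion hq hq1
    (I := fun j => ∫⁻ x, v j x ^ r ∂σ)
    (ENNReal.mul_ne_top hκt (ENNReal.add_ne_top.2 ⟨hC, hμ⟩)) hv₀r hrec
  have hur : ∫⁻ x, u x ^ r ∂σ < ∞ := by
    have : ∀ x, u x ^ r = ⨆ j, v j x ^ r := fun x =>
      (ENNReal.orderIsoRpow r hr).map_iSup _
    simp only [this]
    rw [lintegral_iSup (fun j => (hvm j).pow_const r)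
      (fun i j hij x => ENNReal.rpow_le_rpow (hmono hij x) hr.le)]
    exact (iSup_le hIL).trans_lt hL.lt_top
  refine ⟨u, v, ⟨hum, fun x => ?_, fun K hK => ?_, fun x => ?_⟩,
    (memLp_ofReal_iff hum hr).2 hur, rfl, fun j x => by rw [hsucc], hmono, fun x => rfl⟩
  · exact (hv₀0 x).trans_le (le_iSup (fun j => v j x) 0)
  · calc ∫⁻ x in K, u x ^ q ∂σ ≤ ∫⁻ x in K, (1 + u x ^ r) ∂σ := by
          refine lintegral_mono fun x => ?_
          dsimp only
          rcases le_total (u x) 1 with h | h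
          · exact (ENNReal.rpow_le_one h hq.le).trans le_self_add
          · exact (ENNReal.rpow_le_rpow_of_exponent_le h hqr.le).trans le_add_self
      _ = σ K + ∫⁻ x in K, u x ^ r ∂σ := by
          rw [lintegral_add_left measurable_const, setLIntegral_one]
      _ < ∞ := ENNReal.add_lt_top.2
          ⟨hK.measure_lt_top, (setLIntegral_le_lintegral _ _).trans_lt hur⟩
  · rw [hu, solutionOperator_iSup hG hq σ μ hvm hmono]
    simp only [← hsucc]
    exact (Monotone.iSup_nat_add (f := fun j => v j x) (fun i j hij => hmono hij x) 1).symm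

/-! ### Existence of solutions and necessity of the integrability conditions -/

theorem exists_solution (hG : LowerSemicontinuous fun p : X × X => G p.1 p.2)
    (hpos : ∀ x y, 0 < G x y) {h : ℝ≥0} (h1 : 1 ≤ h) (hW : WeakMaximumPrinciple G h)
    (hQ : QuasiSymmetric G) {q r : ℝ} (hq : 0 < q) (hq1 : q < 1) (hqr : q < r)
    {σ μ : Measure X} [IsLocallyFiniteMeasure σ] (hσ : σ ≠ 0)
    (hB : MemLp (potential G σ) (ENNReal.ofReal (r / (1 - q))) σ)
    (hD : MemLp (potential G μ) (ENNReal.ofReal r) σ) :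
    ∃ u : X → ℝ≥0∞, IsPositiveSolution G q σ μ u ∧ MemLp u (ENNReal.ofReal r) σ ∧
      IsMonotoneIterationLimit G q σ μ u := by
  have h1q : 0 < 1 - q := by linarith
  have hr : 0 < r := hq.trans hqr
  rw [memLp_ofReal_iff (measurable_potential hG σ) (div_pos hr h1q)] at hB
  rw [memLp_ofReal_iff (measurable_potential hG μ) hr] at hD
  obtain ⟨a, _, ha⟩ := hQ
  obtain ⟨C, hC, hstrong⟩ :=
    strong_type hG hpos h1 hW (fun x y => (ha x y).2) hσ hq hq1 hqr hB.ne
  by_cases hμ : μ = 0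
  · obtain ⟨κ, hκ, hle⟩ := exists_subsolution hG hpos h1 hW hq hq1 σ μ
    have hv : Measurable fun x => (κ : ℝ≥0∞) * potential G σ x ^ (1 / (1 - q)) :=
      ((measurable_potential hG σ).pow_const _).const_mul _
    have hv0 : ∀ x, 0 < (κ : ℝ≥0∞) * potential G σ x ^ (1 / (1 - q)) := fun x => by
      have hw : 0 < potential G σ x := potential_pos hG hpos hσ x
      have hw' : potential G σ x ^ (1 / (1 - q)) ≠ 0 := by
        simp [ENNReal.rpow_eq_zero_iff, hw.ne', h1q.not_gt]
      exact ENNReal.mul_pos (by simpa using hκ.ne') hw'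
    have hvr : ∫⁻ x, ((κ : ℝ≥0∞) * potential G σ x ^ (1 / (1 - q))) ^ r ∂σ ≠ ∞ := by
      have heq : ∀ x, ((κ : ℝ≥0∞) * potential G σ x ^ (1 / (1 - q))) ^ r =
          (κ : ℝ≥0∞) ^ r * potential G σ x ^ (r / (1 - q)) := fun x => by
        rw [ENNReal.mul_rpow_of_nonneg _ _ hr.le, ← ENNReal.rpow_mul, one_div_mul_eq_div]
      simp only [heq]
      have hκr : (κ : ℝ≥0∞) ^ r ≠ ∞ := ENNReal.rpow_ne_top_of_nonneg hr.le (by simp)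
      rw [lintegral_const_mul' _ _ hκr]
      exact ENNReal.mul_ne_top hκr hB.ne
    obtain ⟨u, v, hsol, hmem, hv0, hvs, hvm, huv⟩ := exists_solution_of_le_solutionOperator
      hG hq hq1 hqr hC hstrong hD.ne hv hv0 hvr hle
    exact ⟨u, hsol, hmem, v, fun h => absurd hμ h,
      fun _ => ⟨κ, hκ, fun x => congrFun hv0 x⟩, hvs, hvm, huv⟩
  · obtain ⟨u, v, hsol, hmem, hv0, hvs, hvm, huv⟩ := exists_solution_of_le_solutionOperator
      hG hq hq1 hqr hC hstrong hD.ne (measurable_potential hG μ)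
      (potential_pos hG hpos hμ) hD.ne (fun x => le_add_self)
    exact ⟨u, hsol, hmem, v, fun _ => congrFun hv0, fun h => absurd h hμ, hvs, hvm, huv⟩

theorem memLp_potential_of_solution (hG : LowerSemicontinuous fun p : X × X => G p.1 p.2)
    (hpos : ∀ x y, 0 < G x y) {h : ℝ≥0} (h1 : 1 ≤ h) (hW : WeakMaximumPrinciple G h)
    {q r : ℝ} (hq : 0 < q) (hq1 : q < 1) (hr : 0 < r) {σ μ : Measure X} {u : X → ℝ≥0∞}
    (hu : IsPositiveSolution G q σ μ u) (hur : MemLp u (ENNReal.ofReal r) σ) :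
    MemLp (potential G σ) (ENNReal.ofReal (r / (1 - q))) σ ∧
      MemLp (potential G μ) (ENNReal.ofReal r) σ := by
  have h1q : 0 < 1 - q := by linarith
  rw [memLp_ofReal_iff (measurable_potential hG σ) (div_pos hr h1q),
    memLp_ofReal_iff (measurable_potential hG μ) hr]
  rw [memLp_ofReal_iff hu.measurable hr] at hur
  have hsup : ∀ x, ∫⁻ y, G x y * u y ^ q ∂σ + potential G μ x ≤ u x := fun x => by
    rw [← solutionOperator_apply hG q σ μ hu.measurable, ← hu.eq x]
  constructor
  · have hut : ∀ᵐ x ∂σ, u x < ∞ := by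
      filter_upwards [ae_lt_top (hu.measurable.pow_const _) hur.ne] with x hx
      exact (ENNReal.rpow_lt_top_iff_of_pos hr).1 hx
    have key := potential_rpow_le_of_supersolution hG hpos h1 hW hq hq1 σ
      hu.measurable hu.pos hut fun x => le_self_add.trans (hsup x)
    set c := (2 * (2 * (h : ℝ≥0∞)) ^ (1 / (1 - q) - 1)) ^ (1 / (1 - q)) with hc
    have hct : c ≠ ∞ := by
      refine ENNReal.rpow_ne_top_of_nonneg (by positivity) (ENNReal.mul_ne_top (by simp)
        (ENNReal.rpow_ne_top_of_nonneg ?_ (ENNReal.mul_ne_top (by simp) (by simp))))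
      rw [sub_nonneg, le_div_iff₀ h1q]; linarith
    have hcr : c ^ r ≠ ∞ := ENNReal.rpow_ne_top_of_nonneg hr.le hct
    calc ∫⁻ x, potential G σ x ^ (r / (1 - q)) ∂σ
        ≤ ∫⁻ x, c ^ r * u x ^ r ∂σ := by
          refine lintegral_mono fun x => ?_
          dsimp only
          rw [← ENNReal.mul_rpow_of_nonneg _ _ hr.le, ← one_div_mul_eq_div, ENNReal.rpow_mul]
          exact ENNReal.rpow_le_rpow (key x) hr.le
      _ = c ^ r * ∫⁻ x, u x ^ r ∂σ := lintegral_const_mul' _ _ hcr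
      _ < ∞ := ENNReal.mul_lt_top hcr.lt_top hur
  · exact (lintegral_mono fun x =>
      ENNReal.rpow_le_rpow (le_add_self.trans (hsup x)) hr.le).trans_lt hur

end SublinearPotential

theorem theorem4p2 {n : ℕ} (hn : 2 ≤ n) (Ω : Set (EuclideanSpace ℝ (Fin n)))
    (hΩ_open : IsOpen Ω) (hΩ_conn : IsConnected Ω)
    (G : Ω → Ω → ℝ≥0∞) (hG_pos : ∀ x y, 0 < G x y)
    (hG_lsc : LowerSemicontinuous fun p : Ω × Ω => G p.1 p.2)
    (hG_wmp : ∃ h : ℝ≥0, 1 ≤ h ∧ SublinearPotential.WeakMaximumPrinciple G h)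
    (q γ : ℝ) (hq_pos : 0 < q) (hq_lt : q < 1) (hγ : 0 < γ)
    (σ μ : Measure Ω) [IsLocallyFiniteMeasure σ] [IsLocallyFiniteMeasure μ] (hσ : σ ≠ 0) :
    (SublinearPotential.QuasiSymmetric G →
      MemLp (SublinearPotential.potential G σ) (ENNReal.ofReal ((γ + q) / (1 - q))) σ →
      MemLp (SublinearPotential.potential G μ) (ENNReal.ofReal (γ + q)) σ →
      ∃ u : Ω → ℝ≥0∞, SublinearPotential.IsPositiveSolution G q σ μ u ∧
        MemLp u (ENNReal.ofReal (γ + q)) σ ∧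
        SublinearPotential.IsMonotoneIterationLimit G q σ μ u) ∧
    ((∃ u : Ω → ℝ≥0∞, SublinearPotential.IsPositiveSolution G q σ μ u ∧
        MemLp u (ENNReal.ofReal (γ + q)) σ) →
      MemLp (SublinearPotential.potential G σ) (ENNReal.ofReal ((γ + q) / (1 - q))) σ ∧
      MemLp (SublinearPotential.potential G μ) (ENNReal.ofReal (γ + q)) σ) := by
  obtain ⟨h, h1, hW⟩ := hG_wmp
  exact ⟨fun hQ hB hD => SublinearPotential.exists_solution hG_lsc hG_pos h1 hW hQ hq_pos hq_lt
      (by linarith) hσ hB hD,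
    fun ⟨_, hu, hur⟩ => SublinearPotential.memLp_potential_of_solution hG_lsc hG_pos h1 hW hq_pos
      hq_lt (by linarith) hu hur⟩
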